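/- Let $B(x,r)$ denote the open Euclidean ball in $\mathbb{R}^n$. For $E\subset\mathbb{R}^n$ and $\delta\in(0,n]$ let $$\mathcal{H}^\delta_\infty(E):=\inf\Big\{\sum_{i} r_i^\delta : E\subset\bigcup_{i} B(x_i,r_i)\Big\}$$ be the $\delta$-dimensional Hausdorff content, the infimum being over all countable or finite coverings of $E$ by balls. For $\Omega\subset\mathbb{R}^n$ and any function $g:\Omega\to[0,\infty]$ let $$\int_\Omega g\,d\mathcal{H}^\delta_\infty:=\int_0^\infty \mathcal{H}^\delta_\infty(\{x\in\Omega: g(x)>t\})\,dt$$ be the Choquet integral. For $\kappa\in[0,\delta)$ and $f:\mathbb{R}^n\to[-\infty,\infty]$ define the centred fractional maximal function $$\mathcal{M}^\delta_\kappa f(x):=\sup_{r>0}\frac{r^\kappa}{\mathcal{H}^\delta_\infty(B(x,r))}\int_{B(x,r)}|f(y)|\,d\mathcal{H}^\delta_\infty(y).$$ A function $f:\mathbb{R}^n\to[-\infty,\infty]$ is $\mathcal{H}^\delta_\infty$-quasicontinuous if for every $\varepsilon>0$ there is an open set $U\subset\mathbb{R}^n$ with $\mathcal{H}^\delta_\infty(U)\le\varepsilon$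 such that $f|_{\mathbb{R}^n\setminus U}$ is finite and continuous. **Theorem.** Let $n\ge 1$, $\delta\in(0,n)$, $\kappa\in[0,\delta)$ and $p\in(1,\delta/\kappa)$, where $\delta/\kappa:=\infty$ if $\kappa=0$. Then there exists a constant $c<\infty$ depending only on $n,\delta,\kappa$ and $p$ such that $$\Big(\int_{\mathbb{R}^n}\big(\mathcal{M}^\delta_\kappa f(x)\big)^{\frac{\delta p}{\delta-p\kappa}}\,d\mathcal{H}^\delta_\infty\Big)^{\frac{\delta-p\kappa}{\delta p}}\le c\,\Big(\int_{\mathbb{R}^n}|f(x)|^p\,d\mathcal{H}^\delta_\infty\Big)^{\frac1p}$$ for all $\mathcal{H}^\delta_\infty$-quasicontinuous functions $f:\mathbb{R}^n\to[-\infty,\infty]$. -/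

import Mathlib

open scoped ENNReal NNReal

/-- The `δ`-dimensional Hausdorff content of `E`: the infimum of `∑ rᵢ ^ δ` over all countable or
finite coverings of `E` by open balls `B(xᵢ, rᵢ)`. Coverings are sequences; an index with `rᵢ = 0`
stands for an unused ball (`B(x, 0) = ∅` and `0 ^ δ = 0` for `δ > 0`), so that finite coverings
are included. -/
noncomputable def hausdorffContent {X : Type*} [PseudoMetricSpace X] (δ : ℝ) (E : Set X) : ℝ≥0∞ :=
  ⨅ (x : ℕ → X) (r : ℕ → ℝ≥0) (_ : E ⊆ ⋃ i, Metric.ball (x i) (r i)), ∑' i, (r i : ℝ≥0∞) ^ δ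

/-- The Choquet integral `∫_Ω f dH = ∫₀^∞ H({x ∈ Ω : f x > t}) dt` of an arbitrary function
`f : X → [0, ∞]` with respect to a (monotone) set function `H`. -/
noncomputable def choquetIntegral {X : Type*} (H : Set X → ℝ≥0∞) (Ω : Set X) (f : X → ℝ≥0∞) :
    ℝ≥0∞ :=
  ∫⁻ t in Set.Ioi (0 : ℝ), H {x ∈ Ω | ENNReal.ofReal t < f x}

/-- The centred fractional maximal function with respect to the Hausdorff content,
`sup_{r > 0} r ^ κ / H(B(x, r)) * ∫_{B(x, r)} |f| dH` with `H` the `δ`-dimensional Hausdorff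
content. -/
noncomputable def contentMaximalFunction {X : Type*} [PseudoMetricSpace X] (δ κ : ℝ)
    (f : X → EReal) (x : X) : ℝ≥0∞ :=
  ⨆ (r : ℝ) (_ : 0 < r),
    ENNReal.ofReal r ^ κ / hausdorffContent δ (Metric.ball x r) *
      choquetIntegral (hausdorffContent δ) (Metric.ball x r) (fun y => (f y).abs)

/-- `f : X → [-∞, ∞]` is `H`-quasicontinuous: for every `ε > 0` there is an open set `U` with
`H(U) ≤ ε` such that the restriction of `f` to the complement of `U` is finite and continuous. -/
def IsQuasicontinuous {X : Type*} [TopologicalSpace X] (H : Set X → ℝ≥0∞) (f : X → EReal) : Prop :=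
  ∀ ε : ℝ, 0 < ε → ∃ U : Set X, IsOpen U ∧ H U ≤ ENNReal.ofReal ε ∧
    (∀ x ∈ Uᶜ, f x ≠ ⊥ ∧ f x ≠ ⊤) ∧ ContinuousOn f Uᶜ

/-!
The strong-type inequality for the fractional maximal function with respect to the Hausdorff
content `H` of dimension `δ < n` follows from a weak-type inequality for the maximal function of
order `0`, by interpolation and a pointwise inequality of Hedberg type.
All arguments work directly on superlevel sets.

*Weak type.* Each point with `M₀ f > t` is the centre of a ball `B` of radius `r` such that
`t / 2 * r ^ δ ≤ φ B`, where `φ B = ∫_{t/2}^∞ H(B ∩ {|f| > s}) ds`; here `H(B) = r ^ δ`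
(`hausdorffContent_ball`). Since `H` is only subadditive, disjointness of the balls is not enough
to sum these inequalities. It suffices that the balls are *packed*, i.e. that the members of the
family inside any ball of radius `R` have `∑ r_j ^ δ ≤ 2 * R ^ δ`: then
`∑ H(E ∩ B_j) ≤ C * H(E)` for every set `E` (`tsum_hausdorffContent_inter_le`). Conversely, a
maximal packed subfamily of a disjoint Vitali family already has total size comparable to the
content of the set to be covered, because every ball left out lies in a ball saturated by the
selected ones (`exists_packed_subfamily_hausdorffContent_le`).

*Strong type.* Only the part of `|f|` above `t / 2` enters the weak-type bound
(`exists_hausdorffContent_maximal_superlevel_le`), so integration against `p * t ^ (p - 1)` and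
Tonelli's theorem give the case `κ = 0` (`exists_choquetIntegral_maximal_rpow_le`).

*Fractional case.* Truncation bounds the average of `|f|` over a ball of radius `r` by
`2 * a * r ^ (-δ / p)` for every real `a > 0` that is at least the Choquet `L^p` norm of `f`. Using
this bound for the fraction `θ = p * κ / δ` of the average cancels the factor `r ^ κ`, so that
`M_κ f ≤ (2 * a) ^ θ * (M₀ f) ^ (1 - θ)` (`contentMaximalFunction_le_rpow_mul`), and the exponent
`q = δ * p / (δ - p * κ)` satisfies `(1 - θ) * q = p`.
-/

open MeasureTheory Set Metric

/-! ### Hausdorff content -/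

theorem hausdorffContent_mono {X : Type*} [PseudoMetricSpace X] {δ : ℝ} {A B : Set X}
    (h : A ⊆ B) : hausdorffContent δ A ≤ hausdorffContent δ B :=
  le_iInf fun x => le_iInf fun r => le_iInf fun hB =>
    iInf_le_of_le x (iInf_le_of_le r (iInf_le_of_le (h.trans hB) le_rfl))

theorem hausdorffContent_le_tsum {X : Type*} [PseudoMetricSpace X] [Nonempty X] {δ : ℝ}
    (hδ : 0 < δ) {ι : Type*} [Countable ι] {A : Set X} (x : ι → X) (r : ι → ℝ≥0)
    (hA : A ⊆ ⋃ i, ball (x i) (r i)) :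
    hausdorffContent δ A ≤ ∑' i, (r i : ℝ≥0∞) ^ δ := by
  obtain ⟨e, he⟩ := exists_injective_nat ι
  refine (iInf₂_le_of_le (Function.extend e x fun _ => Classical.arbitrary X)
    (Function.extend e r 0) (iInf_le_of_le ?_ le_rfl)).trans (le_of_eq ?_)
  · intro y hy
    obtain ⟨i, hi⟩ := mem_iUnion.1 (hA hy)
    refine mem_iUnion.2 ⟨e i, ?_⟩
    rwa [he.extend_apply, he.extend_apply]
  · rw [← he.tsum_eq]
    · simp only [he.extend_apply]
    · intro k hk
      by_contra hk'
      refine hk ?_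
      simp only
      rw [Function.extend_apply' _ _ _ hk']
      simp [hδ]

theorem hausdorffContent_ball_le {X : Type*} [PseudoMetricSpace X] {δ : ℝ} (hδ : 0 < δ)
    (x : X) (r : ℝ≥0) : hausdorffContent δ (ball x r) ≤ (r : ℝ≥0∞) ^ δ := by
  have : Nonempty X := ⟨x⟩
  simpa using hausdorffContent_le_tsum hδ (ι := Unit) (A := ball x r)
    (fun _ => x) (fun _ => r) (subset_iUnion_of_subset () subset_rfl)

theorem volume_ball_eq_pow_mul {n : ℕ} (hn : 1 ≤ n) (x : EuclideanSpace ℝ (Fin n)) (r : ℝ≥0) :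
    volume (ball x r) = (r : ℝ≥0∞) ^ n * volume (ball (0 : EuclideanSpace ℝ (Fin n)) 1) := by
  have : Nonempty (Fin n) := ⟨⟨0, hn⟩⟩
  rw [Measure.addHaar_ball volume x r.coe_nonneg, finrank_euclideanSpace_fin]
  congr 1
  rw [ENNReal.ofReal_pow r.coe_nonneg]
  simp

/-- The elementary inequality `‖a‖_{ℓ^q} ≤ ‖a‖_{ℓ^1}` for `q ≥ 1`. -/
theorem ENNReal.tsum_rpow_le_rpow_tsum {ι : Type*} (a : ι → ℝ≥0∞) {q : ℝ} (hq : 1 ≤ q) :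
    ∑' i, a i ^ q ≤ (∑' i, a i) ^ q := by
  have key : ∀ b : ℝ≥0∞, b ^ q = b * b ^ (q - 1) := fun b => by
    conv_rhs => rw [← ENNReal.rpow_one b]
    rw [← ENNReal.rpow_mul, one_mul, ← ENNReal.rpow_add_of_nonneg _ _ zero_le_one (by linarith)]
    congr 1; ring
  rw [key (∑' i, a i), ← ENNReal.tsum_mul_right]
  refine ENNReal.tsum_le_tsum fun i => ?_
  rw [key]
  exact mul_le_mul_right (ENNReal.rpow_le_rpow (ENNReal.le_tsum i) (by linarith)) _

/-- The content of a ball is computed by the ball itself: compare the Lebesgue measures of a ball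
and of a covering, and use `δ < n`. -/
theorem hausdorffContent_ball {n : ℕ} (hn : 1 ≤ n) {δ : ℝ} (hδ : 0 < δ) (hδn : δ < n)
    (x : EuclideanSpace ℝ (Fin n)) (r : ℝ≥0) :
    hausdorffContent δ (ball x r) = (r : ℝ≥0∞) ^ δ := by
  have : Nonempty (Fin n) := ⟨⟨0, hn⟩⟩
  refine le_antisymm (hausdorffContent_ball_le hδ x r) ?_
  refine le_iInf fun y => le_iInf fun s => le_iInf fun hc => ?_
  have hn0 : (0 : ℝ) < n := hδ.trans hδn
  have hV0 : volume (ball (0 : EuclideanSpace ℝ (Fin n)) 1) ≠ 0 :=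
    (measure_ball_pos volume _ one_pos).ne'
  have hVt : volume (ball (0 : EuclideanSpace ℝ (Fin n)) 1) ≠ ∞ := measure_ball_lt_top.ne
  have h1 : (r : ℝ≥0∞) ^ n ≤ ∑' i, (s i : ℝ≥0∞) ^ n := by
    rw [← ENNReal.mul_le_mul_iff_left hV0 hVt, ← ENNReal.tsum_mul_right,
      ← volume_ball_eq_pow_mul hn x]
    refine (measure_mono hc).trans ((measure_iUnion_le _).trans ?_)
    simp only [volume_ball_eq_pow_mul hn]
    exact le_rfl
  have h2 : ∑' i, (s i : ℝ≥0∞) ^ n ≤ (∑' i, (s i : ℝ≥0∞) ^ δ) ^ ((n : ℝ) / δ) := by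
    refine le_trans (le_of_eq ?_) (ENNReal.tsum_rpow_le_rpow_tsum _ ((one_le_div hδ).2 hδn.le))
    refine tsum_congr fun i => ?_
    rw [← ENNReal.rpow_mul, mul_div_cancel₀ _ hδ.ne', ENNReal.rpow_natCast]
  have h3 := ENNReal.rpow_le_rpow (h1.trans h2) (div_pos hδ hn0).le
  rwa [← ENNReal.rpow_natCast, ← ENNReal.rpow_mul, ← ENNReal.rpow_mul,
    mul_div_cancel₀ _ hn0.ne', div_mul_div_cancel₀ hδ.ne', div_self hn0.ne',
    ENNReal.rpow_one] at h3

/-! ### Packed families of balls -/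

/-- A family of balls `B(j, r j)`, `j ∈ S`, satisfies the packing condition: the balls contained
in any given ball `B(p, R)` have `∑ r_j ^ δ ≤ 2 * R ^ δ`. Containment is encoded by
`dist j p + r j ≤ R`, which also gives `r j ≤ R`. -/
def IsPackedFamily {X : Type*} [PseudoMetricSpace X] (δ : ℝ) (r : X → ℝ≥0) (S : Set X) : Prop :=
  ∀ (p : X) (R : ℝ≥0), ∑' j : {j ∈ S | dist j p + r j ≤ R}, (r j : ℝ≥0∞) ^ δ ≤ 2 * (R : ℝ≥0∞) ^ δ

/-- At most `3 ^ n` disjoint balls of radius at least `R` meet a given ball of radius `R`: each of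
them contains a ball of radius `R` inside the concentric ball of radius `3 * R`. -/
theorem tsum_one_le_of_disjoint_balls {n : ℕ} (hn : 1 ≤ n)
    {r : EuclideanSpace ℝ (Fin n) → ℝ≥0} {S : Set (EuclideanSpace ℝ (Fin n))}
    (hd : S.PairwiseDisjoint fun j => ball j (r j)) (p : EuclideanSpace ℝ (Fin n)) {R : ℝ≥0}
    (hR : 0 < R) :
    ∑' _ : {j ∈ S | R ≤ r j ∧ (ball j (r j) ∩ ball p R).Nonempty}, (1 : ℝ≥0∞) ≤ 3 ^ n := by
  have hn' : Nonempty (Fin n) := ⟨⟨0, hn⟩⟩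
  set T := {j ∈ S | R ≤ r j ∧ (ball j (r j) ∩ ball p R).Nonempty} with hT
  have hex : ∀ j : T, ∃ c, ball c (R : ℝ) ⊆ ball (j : EuclideanSpace ℝ (Fin n)) (r j) ∧
      ball c (R : ℝ) ⊆ ball p ((3 * R : ℝ≥0) : ℝ) := by
    rintro ⟨j, -, hj, y, hyj, hyp⟩
    have hR' : (0 : ℝ) < R := hR
    have hj' : (R : ℝ) ≤ r j := hj
    have hrj : (0 : ℝ) < r j := hR'.trans_le hj'
    have hθ : (R : ℝ) / r j ≤ 1 := (div_le_one hrj).2 hj'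
    have hθ0 : 0 ≤ (R : ℝ) / r j := by positivity
    rw [mem_ball, dist_eq_norm] at hyj
    have hRθ : (R : ℝ) / r j * r j = R := div_mul_cancel₀ _ hrj.ne'
    -- the centre `c` divides the segment from `y` to `j` in the ratio `R : r j - R`
    refine ⟨y + ((R : ℝ) / r j) • (j - y), ball_subset_ball' ?_, ball_subset_ball' ?_⟩
    · have : y + ((R : ℝ) / r j) • (j - y) - j = (1 - (R : ℝ) / r j) • (y - j) := by module
      rw [dist_eq_norm, this, norm_smul, Real.norm_of_nonneg (by linarith)]
      nlinarith [mul_le_mul_of_nonneg_left hyj.le (by linarith : 0 ≤ 1 - (R : ℝ) / r j)]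
    · have h1 : dist (y + ((R : ℝ) / r j) • (j - y)) y ≤ R := by
        rw [dist_eq_norm, add_sub_cancel_left, norm_smul, Real.norm_of_nonneg hθ0,
          norm_sub_rev]
        nlinarith [mul_le_mul_of_nonneg_left hyj.le hθ0]
      have h2 := dist_triangle (y + ((R : ℝ) / r j) • (j - y)) y p
      have h3 : dist y p < R := hyp
      push_cast
      linarith
  choose c hc1 hc2 using hex
  have hdis : Pairwise (Function.onFun Disjoint fun j : T => ball (c j) (R : ℝ)) := by
    intro i j hij
    exact (hd i.2.1 j.2.1 fun h => hij (Subtype.ext h)).mono (hc1 i) (hc1 j)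
  have hm := (tsum_meas_le_meas_iUnion_of_disjoint volume (fun j => measurableSet_ball) hdis).trans
    (measure_mono (iUnion_subset hc2))
  have hV : volume (ball p (R : ℝ)) ≠ 0 := (measure_ball_pos volume _ (by exact_mod_cast hR)).ne'
  have hVt : volume (ball p (R : ℝ)) ≠ ∞ := measure_ball_lt_top.ne
  rw [← ENNReal.mul_le_mul_iff_left hV hVt, ← ENNReal.tsum_mul_right]
  have e1 : volume (ball p ((3 * R : ℝ≥0) : ℝ)) = 3 ^ n * volume (ball p (R : ℝ)) := by
    rw [volume_ball_eq_pow_mul hn, volume_ball_eq_pow_mul hn p R]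
    push_cast
    rw [mul_pow, mul_assoc]
  rw [← e1]
  refine le_trans (le_of_eq (tsum_congr fun j => ?_)) hm
  rw [one_mul, volume_ball_eq_pow_mul hn, volume_ball_eq_pow_mul hn (c j)]

/-- Superadditivity of the content along a packed family of disjoint balls. Each ball of a covering
of `E` is charged either with the members of the family that are smaller (controlled by the
packing condition) or with those that are larger (boundedly many, by disjointness). -/
theorem tsum_hausdorffContent_inter_le {n : ℕ} (hn : 1 ≤ n) {δ : ℝ} (hδ : 0 < δ)
    {r : EuclideanSpace ℝ (Fin n) → ℝ≥0} {S : Set (EuclideanSpace ℝ (Fin n))}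
    (hd : S.PairwiseDisjoint fun j => ball j (r j)) (hp : IsPackedFamily δ r S)
    (E : Set (EuclideanSpace ℝ (Fin n))) :
    ∑' j : S, hausdorffContent δ (ball (j : EuclideanSpace ℝ (Fin n)) (r j) ∩ E) ≤
      (2 * 3 ^ δ + 3 ^ n) * hausdorffContent δ E := by
  classical
  have hC0 : (2 * 3 ^ δ + 3 ^ n : ℝ≥0∞) ≠ 0 := by simp
  have hCt : (2 * 3 ^ δ + 3 ^ n : ℝ≥0∞) ≠ ∞ := by
    finiteness [ENNReal.rpow_ne_top_of_nonneg hδ.le (by simp : (3 : ℝ≥0∞) ≠ ∞)]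
  rw [mul_comm, ← ENNReal.div_le_iff hC0 hCt]
  refine le_iInf fun p => le_iInf fun R => le_iInf fun hc => ?_
  rw [ENNReal.div_le_iff hC0 hCt, mul_comm, ← ENNReal.tsum_mul_left]
  set small : ℕ → Set (EuclideanSpace ℝ (Fin n)) := fun k =>
    {j ∈ S | dist j (p k) + r j ≤ (3 * R k : ℝ≥0)} with hsmall
  set large : ℕ → Set (EuclideanSpace ℝ (Fin n)) := fun k =>
    {j ∈ S | R k ≤ r j ∧ (ball j (r j) ∩ ball (p k) (R k)).Nonempty} with hlarge
  have hle : ∀ j : S, hausdorffContent δ (ball (j : EuclideanSpace ℝ (Fin n)) (r j) ∩ E) ≤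
      ∑' k, ((small k).indicator (fun j => (r j : ℝ≥0∞) ^ δ) j +
        (large k).indicator (fun _ => (R k : ℝ≥0∞) ^ δ) j) := by
    rintro ⟨j, hj⟩
    by_cases h : ∃ k, j ∈ small k
    · obtain ⟨k, hk⟩ := h
      refine (hausdorffContent_mono inter_subset_left).trans
        ((hausdorffContent_ball_le hδ j (r j)).trans ?_)
      refine le_trans ?_ (ENNReal.le_tsum k)
      rw [indicator_of_mem hk]
      exact le_self_add
    · push Not at h
      refine (hausdorffContent_le_tsum hδ p (fun k => if j ∈ large k then R k else 0) ?_).trans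
        (ENNReal.tsum_le_tsum fun k => ?_)
      · rintro y ⟨hyj, hyE⟩
        obtain ⟨k, hk⟩ := mem_iUnion.1 (hc hyE)
        have hjk : j ∈ large k := by
          refine ⟨hj, ?_, y, hyj, hk⟩
          by_contra hlt
          refine h k ⟨hj, ?_⟩
          have h1 : (r j : ℝ) < R k := by exact_mod_cast not_le.1 hlt
          have h2 := dist_triangle_left j (p k) y
          rw [mem_ball] at hyj hk
          push_cast
          linarith
        exact mem_iUnion.2 ⟨k, by simpa [hjk] using hk⟩
      · by_cases hjk : j ∈ large k
        · simp [hjk]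
        · simp [hjk, hδ]
  refine (ENNReal.tsum_le_tsum hle).trans ?_
  rw [ENNReal.tsum_comm]
  refine ENNReal.tsum_le_tsum fun k => ?_
  rw [ENNReal.tsum_add, add_mul]
  have hsub : ∀ (T : Set (EuclideanSpace ℝ (Fin n))) (a : EuclideanSpace ℝ (Fin n) → ℝ≥0∞),
      ∑' j : S, T.indicator a j ≤ ∑' j : T, a j := fun T a => by
    rw [tsum_subtype T a]
    exact ENNReal.tsum_comp_le_tsum_of_injective Subtype.val_injective _
  refine add_le_add ((hsub _ _).trans ((hp (p k) (3 * R k)).trans (le_of_eq ?_))) ?_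
  · push_cast
    rw [ENNReal.mul_rpow_of_nonneg _ _ hδ.le, mul_assoc]
  · rcases eq_or_ne (R k) 0 with h0 | h0
    · simp [h0, hδ]
    refine (hsub _ _).trans ?_
    have := mul_le_mul_left (tsum_one_le_of_disjoint_balls hn hd (p k)
      (pos_iff_ne_zero.2 h0)) ((R k : ℝ≥0∞) ^ δ)
    rw [← ENNReal.tsum_mul_right] at this
    simpa only [one_mul] using this

/-! ### A covering lemma -/

/-- Every family of balls contains a maximal packed subfamily. A ball left out lies in a ball
`B(p, R)` that is saturated: the chosen balls inside it have `∑ r_j ^ δ > R ^ δ`. -/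
theorem exists_isPackedFamily_subset {X : Type*} [PseudoMetricSpace X] {δ : ℝ} (hδ : 0 < δ)
    (r : X → ℝ≥0) (u : Set X) :
    ∃ S ⊆ u, IsPackedFamily δ r S ∧ ∀ a ∈ u, a ∉ S → ∃ (p : X) (R : ℝ≥0),
      dist a p + r a ≤ R ∧
        (R : ℝ≥0∞) ^ δ < ∑' j : {j ∈ S | dist j p + r j ≤ R}, (r j : ℝ≥0∞) ^ δ := by
  obtain ⟨S, hS⟩ := zorn_subset {S | S ⊆ u ∧ IsPackedFamily δ r S} (by
    intro c hc hchain
    refine ⟨⋃₀ c, ⟨sUnion_subset fun s hs => (hc hs).1, fun p R => ?_⟩,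
      fun s hs => subset_sUnion_of_mem hs⟩
    rcases c.eq_empty_or_nonempty with rfl | hne
    · simp
    rw [ENNReal.tsum_eq_iSup_sum]
    refine iSup_le fun t => ?_
    obtain ⟨s, hs, hts⟩ := DirectedOn.exists_mem_subset_of_finite_of_subset_sUnion hne
      hchain.directedOn (t.finite_toSet.image Subtype.val)
      (by rintro _ ⟨j, -, rfl⟩; exact j.2.1)
    have hinj : ∑ j ∈ t, (r j : ℝ≥0∞) ^ δ =
        ∑' j : (Subtype.val '' (t : Set {j ∈ ⋃₀ c | dist j p + r j ≤ R}) : Set X),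
          (r j : ℝ≥0∞) ^ δ := by
      rw [tsum_image (fun j : X => (r j : ℝ≥0∞) ^ δ) Subtype.val_injective.injOn,
        ← Finset.tsum_subtype]
      rfl
    rw [hinj]
    refine (ENNReal.tsum_mono_subtype (fun j : X => (r j : ℝ≥0∞) ^ δ) ?_).trans ((hc hs).2 p R)
    rintro j hj
    refine ⟨hts hj, ?_⟩
    obtain ⟨j', -, rfl⟩ := hj
    exact j'.2.2)
  refine ⟨S, hS.prop.1, hS.prop.2, fun a hau haS => ?_⟩
  have hnot : ¬ IsPackedFamily δ r (insert a S) := fun h =>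
    haS (hS.le_of_ge (y := insert a S) ⟨insert_subset hau hS.prop.1, h⟩ (subset_insert a S)
      (mem_insert a S))
  simp only [IsPackedFamily, not_forall, not_le] at hnot
  obtain ⟨p, R, hpR⟩ := hnot
  have ha : dist a p + r a ≤ R := by
    by_contra hcon
    refine hpR.not_ge ((ENNReal.tsum_mono_subtype (fun j : X => (r j : ℝ≥0∞) ^ δ) ?_).trans
      (hS.prop.2 p R))
    rintro j ⟨rfl | hj, hj'⟩
    · exact absurd hj' hcon
    · exact ⟨hj, hj'⟩
  refine ⟨p, R, ha, ?_⟩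
  have hle : ∑' j : {j ∈ insert a S | dist j p + r j ≤ R}, (r j : ℝ≥0∞) ^ δ ≤
      (R : ℝ≥0∞) ^ δ + ∑' j : {j ∈ S | dist j p + r j ≤ R}, (r j : ℝ≥0∞) ^ δ := by
    have hsub : {j ∈ insert a S | dist j p + r j ≤ R} ⊆
        {a} ∪ {j ∈ S | dist j p + r j ≤ R} := by
      rintro j ⟨rfl | hj, hj'⟩
      · exact Or.inl rfl
      · exact Or.inr ⟨hj, hj'⟩
    refine (ENNReal.tsum_mono_subtype (fun j : X => (r j : ℝ≥0∞) ^ δ) hsub).trans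
      ((ENNReal.tsum_union_le (fun j : X => (r j : ℝ≥0∞) ^ δ) _ _).trans ?_)
    gcongr
    rw [tsum_singleton a (fun j : X => (r j : ℝ≥0∞) ^ δ)]
    have : (r a : ℝ) ≤ R := by linarith [dist_nonneg (x := a) (y := p)]
    exact ENNReal.rpow_le_rpow (by exact_mod_cast this) hδ.le
  rw [two_mul] at hpR
  exact lt_of_add_lt_add_left (hpR.trans_le hle)

/-- Covering lemma: from balls centred at the points of `F` one can select a disjoint packed
subfamily whose total size controls the content of `F`. Vitali's lemma makes the family disjoint,
a maximal packed subfamily `S` is taken, and the balls left out are covered by enlarged saturated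
balls, again chosen disjoint, whose total size is at most that of `S`. -/
theorem exists_packed_subfamily_hausdorffContent_le {X : Type*} [PseudoMetricSpace X]
    [TopologicalSpace.SeparableSpace X] [Nonempty X] {δ : ℝ} (hδ : 0 < δ) (F : Set X) (r : X → ℝ≥0)
    (hr : ∀ x ∈ F, 0 < r x) (M : ℝ≥0) (hM : ∀ x ∈ F, r x ≤ M) :
    ∃ S ⊆ F, S.PairwiseDisjoint (fun j => ball j (r j)) ∧ IsPackedFamily δ r S ∧
      hausdorffContent δ F ≤ (3 ^ δ + 11 ^ δ) * ∑' j : S, (r j : ℝ≥0∞) ^ δ := by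
  obtain ⟨u, huF, hud, hu⟩ := Vitali.exists_disjoint_subfamily_covering_enlargement
    (fun j => ball j (r j)) F (fun j => (r j : ℝ)) 2 one_lt_two (fun j _ => (r j).coe_nonneg) M
    (fun j hj => by exact_mod_cast hM j hj) (fun j hj => ⟨j, mem_ball_self (hr j hj)⟩)
  obtain ⟨S, hSu, hSp, hS⟩ := exists_isPackedFamily_subset hδ r u
  have hSd := hud.subset hSu
  refine ⟨S, hSu.trans huF, hSd, hSp, ?_⟩
  have hScount : Countable S := (hSd.countable_of_isOpen (fun _ _ => isOpen_ball)
    (fun j hj => ⟨j, mem_ball_self (hr j (huF (hSu hj)))⟩)).to_subtype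
  rcases eq_or_ne (∑' j : S, (r j : ℝ≥0∞) ^ δ) ∞ with htop | hfin
  · rw [htop, ENNReal.mul_top (by simp)]
    exact le_top
  set T : Set (X × ℝ≥0) := {q | 0 < q.2 ∧
    (q.2 : ℝ≥0∞) ^ δ < ∑' j : {j ∈ S | dist j q.1 + r j ≤ q.2}, (r j : ℝ≥0∞) ^ δ} with hT
  have hTb : ∀ q ∈ T, (q.2 : ℝ) ≤ ((∑' j : S, (r j : ℝ≥0∞) ^ δ) ^ δ⁻¹).toReal := by
    rintro ⟨p, R⟩ ⟨-, hR⟩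
    have h1 : (R : ℝ≥0∞) ^ δ ≤ ∑' j : S, (r j : ℝ≥0∞) ^ δ := hR.le.trans
      (ENNReal.tsum_mono_subtype (fun j : X => (r j : ℝ≥0∞) ^ δ) (sep_subset _ _))
    have h2 := ENNReal.rpow_le_rpow h1 (inv_nonneg.2 hδ.le)
    rw [ENNReal.rpow_rpow_inv hδ.ne'] at h2
    exact ENNReal.toReal_mono (ENNReal.rpow_ne_top_of_nonneg (inv_nonneg.2 hδ.le) hfin) h2
  obtain ⟨v, hvT, hvd, hv⟩ := Vitali.exists_disjoint_subfamily_covering_enlargement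
    (fun q : X × ℝ≥0 => ball q.1 (q.2 : ℝ)) T (fun q => (q.2 : ℝ)) 2 one_lt_two
    (fun q _ => q.2.coe_nonneg) _ hTb (fun q hq => ⟨q.1, mem_ball_self hq.1⟩)
  have hvcount : Countable v := (hvd.countable_of_isOpen (fun _ _ => isOpen_ball)
    (fun q hq => ⟨q.1, mem_ball_self (hvT hq).1⟩)).to_subtype
  have hvsum : ∑' q : v, (q.1.2 : ℝ≥0∞) ^ δ ≤ ∑' j : S, (r j : ℝ≥0∞) ^ δ := by
    have hdis : v.PairwiseDisjoint
        fun q : X × ℝ≥0 => {j ∈ S | dist j q.1 + r j ≤ q.2} := by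
      intro q hq q' hq' hne
      refine Disjoint.mono ?_ ?_ (hvd hq hq' hne) <;>
      · rintro j ⟨hjS, hj⟩
        have : (0 : ℝ) < r j := hr j (huF (hSu hjS))
        exact mem_ball.2 (by linarith)
    calc ∑' q : v, (q.1.2 : ℝ≥0∞) ^ δ
        ≤ ∑' q : v, ∑' j : {j ∈ S | dist j q.1.1 + r j ≤ q.1.2}, (r j : ℝ≥0∞) ^ δ :=
          ENNReal.tsum_le_tsum fun q => (hvT q.2).2.le
      _ = ∑' j : ⋃ q ∈ v, {j ∈ S | dist j q.1 + r j ≤ q.2}, (r j : ℝ≥0∞) ^ δ :=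
          (ENNReal.tsum_biUnion' (f := fun j : X => (r j : ℝ≥0∞) ^ δ) hdis).symm
      _ ≤ ∑' j : S, (r j : ℝ≥0∞) ^ δ :=
          ENNReal.tsum_mono_subtype (fun j : X => (r j : ℝ≥0∞) ^ δ)
            (iUnion₂_subset fun q _ => sep_subset _ _)
  have hcov : F ⊆ ⋃ i : S ⊕ v, ball (Sum.elim (fun j : S => (j : X)) (fun q : v => q.1.1) i)
      (Sum.elim (fun j : S => 3 * r j) (fun q : v => 11 * q.1.2) i : ℝ≥0) := by
    intro x hx
    obtain ⟨j, hju, ⟨y, hyx, hyj⟩, hxj⟩ := hu x hx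
    simp only [mem_ball] at hyx hyj
    have hxj3 : dist x j < 3 * r j := by
      linarith [dist_triangle_left x j y]
    by_cases hjS : j ∈ S
    · exact mem_iUnion.2 ⟨Sum.inl ⟨j, hjS⟩, by simpa using hxj3⟩
    · obtain ⟨p, R, hpR, hR⟩ := hS j hju hjS
      have hrj : (0 : ℝ) < r j := hr j (huF hju)
      have hjp := dist_nonneg (x := j) (y := p)
      have hR0 : (0 : ℝ) < R := by linarith
      obtain ⟨q, hqv, ⟨z, hzp, hzq⟩, hRq⟩ := hv (p, R) ⟨by exact_mod_cast hR0, hR⟩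
      simp only [mem_ball] at hzp hzq hRq
      refine mem_iUnion.2 ⟨Sum.inr ⟨q, hqv⟩, ?_⟩
      -- `dist x j < 3 R`, `dist j p ≤ R`, `dist p q < R + R_q` and `R ≤ 2 R_q`
      have : dist x q.1 < 11 * q.2 := by
        linarith [dist_triangle x j p, dist_triangle x p q.1, dist_triangle_left p q.1 z]
      simpa using this
  refine (hausdorffContent_le_tsum hδ _ _ hcov).trans ?_
  rw [Summable.tsum_sum (f := fun i : S ⊕ v => ((Sum.elim (fun j : S => 3 * r j)
    (fun q : v => 11 * q.1.2) i : ℝ≥0) : ℝ≥0∞) ^ δ) ENNReal.summable ENNReal.summable]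
  simp only [Sum.elim_inl, Sum.elim_inr, ENNReal.coe_mul, ENNReal.mul_rpow_of_nonneg _ _ hδ.le,
    ENNReal.tsum_mul_left, add_mul]
  gcongr
  · norm_num
  · norm_num

/-! ### Choquet integrals -/

theorem measurable_hausdorffContent_superlevel {X : Type*} [PseudoMetricSpace X] (δ : ℝ)
    (A : Set X) (g : X → ℝ≥0∞) :
    Measurable fun s : ℝ => hausdorffContent δ {x ∈ A | ENNReal.ofReal s < g x} :=
  Antitone.measurable fun _ _ hst => hausdorffContent_mono fun _ hx =>
    ⟨hx.1, (ENNReal.ofReal_le_ofReal hst).trans_lt hx.2⟩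

theorem choquetIntegral_mono {X : Type*} [PseudoMetricSpace X] {δ : ℝ} {A B : Set X}
    {g h : X → ℝ≥0∞} (hAB : A ⊆ B) (hgh : ∀ x, g x ≤ h x) :
    choquetIntegral (hausdorffContent δ) A g ≤ choquetIntegral (hausdorffContent δ) B h :=
  lintegral_mono fun _ => hausdorffContent_mono fun x hx => ⟨hAB hx.1, hx.2.trans_le (hgh x)⟩

/-- Truncation of a Choquet integral at height `l`. -/
theorem choquetIntegral_le_add {X : Type*} [PseudoMetricSpace X] {δ : ℝ} (A : Set X)
    (g : X → ℝ≥0∞) {l : ℝ} (hl : 0 ≤ l) :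
    choquetIntegral (hausdorffContent δ) A g ≤ ENNReal.ofReal l * hausdorffContent δ A +
      ∫⁻ s in Ioi l, hausdorffContent δ {x ∈ A | ENNReal.ofReal s < g x} := by
  rw [choquetIntegral, ← Ioc_union_Ioi_eq_Ioi hl]
  refine (lintegral_union_le _ _ _).trans (add_le_add_left ?_ _)
  calc ∫⁻ s in Ioc 0 l, hausdorffContent δ {x ∈ A | ENNReal.ofReal s < g x}
      ≤ ∫⁻ _ in Ioc 0 l, hausdorffContent δ A :=
        lintegral_mono fun _ => hausdorffContent_mono (sep_subset _ _)
    _ = ENNReal.ofReal l * hausdorffContent δ A := by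
        rw [setLIntegral_const, Real.volume_Ioc, sub_zero, mul_comm]

/-- Layer-cake formula for powers, by the substitution `τ = c * t ^ p`. -/
theorem choquetIntegral_const_mul_rpow {X : Type*} [PseudoMetricSpace X] {δ : ℝ} (A : Set X)
    (g : X → ℝ≥0∞) {p c : ℝ} (hp : 0 < p) (hc : 0 < c) :
    choquetIntegral (hausdorffContent δ) A (fun x => ENNReal.ofReal c * g x ^ p) =
      ENNReal.ofReal c * ∫⁻ t in Ioi (0 : ℝ), ENNReal.ofReal (p * t ^ (p - 1)) *
        hausdorffContent δ {x ∈ A | ENNReal.ofReal t < g x} := by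
  have him : (fun t : ℝ => c * t ^ p) '' Ioi 0 = Ioi 0 := by
    ext y
    constructor
    · rintro ⟨t, ht, rfl⟩
      exact mul_pos hc (Real.rpow_pos_of_pos ht p)
    · intro hy
      have hyc : 0 < y / c := div_pos hy hc
      refine ⟨(y / c) ^ p⁻¹, Real.rpow_pos_of_pos hyc _, ?_⟩
      simp only
      rw [Real.rpow_inv_rpow hyc.le hp.ne', mul_div_cancel₀ _ hc.ne']
  have hinj : InjOn (fun t : ℝ => c * t ^ p) (Ioi 0) := fun s hs t ht hst =>
    (Real.rpow_left_inj (le_of_lt hs) (le_of_lt ht) hp.ne').1 (mul_left_cancel₀ hc.ne' hst)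
  have hder : ∀ t ∈ Ioi (0 : ℝ), HasDerivWithinAt (fun t : ℝ => c * t ^ p)
      (c * (p * t ^ (p - 1))) (Ioi 0) t := fun t ht =>
    ((Real.hasDerivAt_rpow_const (Or.inl (ne_of_gt ht))).const_mul c).hasDerivWithinAt
  have h := lintegral_image_eq_lintegral_abs_deriv_mul measurableSet_Ioi hder hinj
    fun τ => hausdorffContent δ {x ∈ A | ENNReal.ofReal τ < ENNReal.ofReal c * g x ^ p}
  rw [him] at h
  rw [choquetIntegral, h, ← lintegral_const_mul' _ _ ENNReal.ofReal_ne_top]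
  refine setLIntegral_congr_fun measurableSet_Ioi fun t (ht : 0 < t) => ?_
  have h1 : 0 ≤ p * t ^ (p - 1) := by positivity
  rw [abs_of_nonneg (by positivity), ENNReal.ofReal_mul hc.le, mul_assoc]
  congr 4
  ext x
  rw [ENNReal.ofReal_mul hc.le, ← ENNReal.ofReal_rpow_of_pos ht,
    ENNReal.mul_lt_mul_iff_right (by simpa using hc) ENNReal.ofReal_ne_top,
    ENNReal.rpow_lt_rpow_iff hp]

theorem choquetIntegral_rpow {X : Type*} [PseudoMetricSpace X] {δ : ℝ} (A : Set X)
    (g : X → ℝ≥0∞) {p : ℝ} (hp : 0 < p) :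
    choquetIntegral (hausdorffContent δ) A (fun x => g x ^ p) =
      ∫⁻ t in Ioi (0 : ℝ), ENNReal.ofReal (p * t ^ (p - 1)) *
        hausdorffContent δ {x ∈ A | ENNReal.ofReal t < g x} := by
  simpa using choquetIntegral_const_mul_rpow (δ := δ) A g hp one_pos

/-- The Hardy-type identity behind Marcinkiewicz interpolation:
`∫₀^∞ p t^{p-2} ∫_{t/2}^∞ h(s) ds dt = 2^{p-1} / (p-1) * ∫₀^∞ p s^{p-1} h(s) ds`. -/
theorem lintegral_rpow_mul_lintegral_Ioi_half {h : ℝ → ℝ≥0∞} (hh : Measurable h) {p : ℝ}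
    (hp : 1 < p) :
    ∫⁻ t in Ioi (0 : ℝ), ENNReal.ofReal (p * t ^ (p - 2)) * ∫⁻ s in Ioi (t / 2), h s =
      ENNReal.ofReal (2 ^ (p - 1) / (p - 1)) *
        ∫⁻ s in Ioi (0 : ℝ), ENNReal.ofReal (p * s ^ (p - 1)) * h s := by
  have hmeas : Measurable (Function.uncurry fun t s : ℝ => ENNReal.ofReal (p * t ^ (p - 2)) *
      (Ioi (t / 2)).indicator h s) := by
    have hset : MeasurableSet {q : ℝ × ℝ | q.1 / 2 < q.2} :=
      measurableSet_lt (by fun_prop) (by fun_prop)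
    have : (Function.uncurry fun t s : ℝ => (Ioi (t / 2)).indicator h s) =
        {q : ℝ × ℝ | q.1 / 2 < q.2}.indicator fun q => h q.2 := by
      ext ⟨t, s⟩
      simp [Function.uncurry, indicator]
    refine Measurable.mul (by fun_prop) ?_
    change Measurable (Function.uncurry fun t s : ℝ => (Ioi (t / 2)).indicator h s)
    rw [this]
    exact (hh.comp measurable_snd).indicator hset
  have hin : ∀ s : ℝ, 0 < s → ∫⁻ t in Ioi (0 : ℝ), ENNReal.ofReal (p * t ^ (p - 2)) *
      (Ioi (t / 2)).indicator h s =
      ENNReal.ofReal (2 ^ (p - 1) / (p - 1)) * (ENNReal.ofReal (p * s ^ (p - 1)) * h s) := by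
    intro s hs
    have e1 : ∀ t : ℝ, ENNReal.ofReal (p * t ^ (p - 2)) * (Ioi (t / 2)).indicator h s =
        (Iio (2 * s)).indicator (fun t => ENNReal.ofReal (p * t ^ (p - 2)) * h s) t := by
      intro t
      by_cases hts : t / 2 < s
      · rw [indicator_of_mem (mem_Ioi.2 hts), indicator_of_mem (mem_Iio.2 (by linarith))]
      · rw [indicator_of_notMem (by simpa using hts), indicator_of_notMem, mul_zero]
        rw [mem_Iio]; intro h'; exact hts (by linarith)
    simp only [e1]
    rw [lintegral_indicator measurableSet_Iio, Measure.restrict_restrict measurableSet_Iio,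
      Iio_inter_Ioi, lintegral_mul_const _ (by fun_prop)]
    have hint : IntegrableOn (fun t : ℝ => p * t ^ (p - 2)) (Ioc 0 (2 * s)) := by
      rw [← intervalIntegrable_iff_integrableOn_Ioc_of_le (by linarith)]
      exact (intervalIntegral.intervalIntegrable_rpow' (by linarith)).const_mul p
    rw [restrict_Ioo_eq_restrict_Ioc, ← ofReal_integral_eq_lintegral_ofReal hint,
      ← intervalIntegral.integral_of_le (by linarith), intervalIntegral.integral_const_mul,
      integral_rpow (Or.inl (by linarith)), ← mul_assoc]
    · congr 1
      have hp1 : (0 : ℝ) < p - 1 := by linarith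
      rw [← ENNReal.ofReal_mul (by positivity)]
      congr 1
      have e2 : p - 2 + 1 = p - 1 := by ring
      rw [e2, Real.zero_rpow hp1.ne', Real.mul_rpow zero_le_two hs.le]
      ring
    · refine (ae_restrict_mem measurableSet_Ioc).mono fun t ht => ?_
      have := ht.1
      simp only [Pi.zero_apply]
      positivity
  calc ∫⁻ t in Ioi (0 : ℝ), ENNReal.ofReal (p * t ^ (p - 2)) * ∫⁻ s in Ioi (t / 2), h s
      = ∫⁻ t in Ioi (0 : ℝ), ∫⁻ s in Ioi (0 : ℝ), ENNReal.ofReal (p * t ^ (p - 2)) *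
          (Ioi (t / 2)).indicator h s := by
        refine setLIntegral_congr_fun measurableSet_Ioi fun t (ht : 0 < t) => ?_
        rw [lintegral_const_mul' _ _ ENNReal.ofReal_ne_top, lintegral_indicator measurableSet_Ioi,
          Measure.restrict_restrict measurableSet_Ioi, inter_eq_left.2]
        exact Ioi_subset_Ioi (by positivity)
    _ = ∫⁻ s in Ioi (0 : ℝ), ∫⁻ t in Ioi (0 : ℝ), ENNReal.ofReal (p * t ^ (p - 2)) *
          (Ioi (t / 2)).indicator h s := lintegral_lintegral_swap hmeas.aemeasurable
    _ = _ := by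
        rw [← lintegral_const_mul' _ _ ENNReal.ofReal_ne_top]
        exact setLIntegral_congr_fun measurableSet_Ioi hin

/-! ### Maximal functions -/

/-- Truncated weak-type bound for the maximal function of order `0`: only the part of `f` above
height `t / 2` matters, since the rest contributes at most `t / 2` to each average. -/
theorem exists_hausdorffContent_maximal_superlevel_le {n : ℕ} (hn : 1 ≤ n) {δ : ℝ} (hδ : 0 < δ)
    (hδn : δ < n) :
    ∃ C : ℝ≥0∞, C ≠ ∞ ∧ ∀ (f : EuclideanSpace ℝ (Fin n) → EReal) (t : ℝ), 0 < t →
      hausdorffContent δ {x ∈ univ | ENNReal.ofReal t < contentMaximalFunction δ 0 f x} ≤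
        C * ENNReal.ofReal t⁻¹ *
          ∫⁻ s in Ioi (t / 2), hausdorffContent δ {x ∈ univ | ENNReal.ofReal s < (f x).abs} := by
  have hrp : ∀ a : ℝ≥0, (a : ℝ≥0∞) ^ δ ≠ ∞ := fun a =>
    ENNReal.rpow_ne_top_of_nonneg hδ.le ENNReal.coe_ne_top
  refine ⟨(3 ^ δ + 11 ^ δ) * (2 * (2 * 3 ^ δ + 3 ^ n)), ?_, fun f t ht => ?_⟩
  · finiteness [hrp 3, hrp 11]
  set φ : Set (EuclideanSpace ℝ (Fin n)) → ℝ≥0∞ := fun A =>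
    ∫⁻ s in Ioi (t / 2), hausdorffContent δ {x ∈ A | ENNReal.ofReal s < (f x).abs} with hφ
  set F := {x ∈ univ | ENNReal.ofReal t < contentMaximalFunction δ 0 f x} with hF
  change hausdorffContent δ F ≤ _ * φ univ
  have ht0 : ENNReal.ofReal t⁻¹ ≠ 0 := by simpa using ht
  have hconv : ENNReal.ofReal (t / 2) = (2 * ENNReal.ofReal t⁻¹)⁻¹ := by
    have h2 : (2 : ℝ≥0∞) = ENNReal.ofReal 2 := by simp
    rw [h2, ← ENNReal.ofReal_mul zero_le_two, ← ENNReal.ofReal_inv_of_pos (by positivity)]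
    congr 1
    field_simp
  have hsize : ∀ (R : ℝ≥0∞) (A : ℝ≥0∞), ENNReal.ofReal (t / 2) * R ≤ A →
      R ≤ 2 * ENNReal.ofReal t⁻¹ * A := by
    intro R A h
    rw [hconv, mul_comm, ← div_eq_mul_inv, ENNReal.div_le_iff] at h
    · rwa [mul_comm]
    · simp [ht]
    · finiteness
  rcases eq_or_ne (φ univ) ∞ with htop | hfin
  · rw [htop, ENNReal.mul_top]
    · exact le_top
    · simp [ht]
  have hex : ∀ x ∈ F, ∃ r : ℝ≥0, 0 < r ∧
      (r : ℝ≥0∞) ^ δ ≤ 2 * ENNReal.ofReal t⁻¹ * φ (ball x r) := by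
    rintro x ⟨-, hx⟩
    obtain ⟨r, hx⟩ := lt_iSup_iff.1 hx
    obtain ⟨hr, hx⟩ := lt_iSup_iff.1 hx
    lift r to ℝ≥0 using hr.le
    have hr' : 0 < r := by exact_mod_cast hr
    refine ⟨r, hr', hsize _ _ ?_⟩
    have hr0 : (r : ℝ≥0∞) ^ δ ≠ 0 := by simp [hr'.ne', hδ.not_gt]
    rw [ENNReal.rpow_zero, hausdorffContent_ball hn hδ hδn, one_div, mul_comm, ← div_eq_mul_inv,
      ENNReal.lt_div_iff_mul_lt (Or.inl hr0) (Or.inl (hrp r))] at hx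
    have h1 := hx.trans_le (choquetIntegral_le_add (δ := δ) (ball x r) (fun y => (f y).abs)
      (half_pos ht).le)
    rw [hausdorffContent_ball hn hδ hδn] at h1
    have h2 : ENNReal.ofReal t * (r : ℝ≥0∞) ^ δ = ENNReal.ofReal (t / 2) * (r : ℝ≥0∞) ^ δ +
        ENNReal.ofReal (t / 2) * (r : ℝ≥0∞) ^ δ := by
      rw [← add_mul, ← ENNReal.ofReal_add (half_pos ht).le (half_pos ht).le, add_halves]
    rw [h2] at h1
    exact (lt_of_add_lt_add_left h1).le
  choose! r hr hrφ using hex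
  have hφmono : ∀ A, φ A ≤ φ univ := fun A =>
    lintegral_mono fun s => hausdorffContent_mono fun y hy => ⟨mem_univ y, hy.2⟩
  have hΛ : (2 * ENNReal.ofReal t⁻¹ * φ univ) ^ δ⁻¹ ≠ ∞ :=
    ENNReal.rpow_ne_top_of_nonneg (inv_nonneg.2 hδ.le) (by finiteness)
  obtain ⟨S, hSF, hSd, hSp, hS⟩ := exists_packed_subfamily_hausdorffContent_le hδ F r hr
    ((2 * ENNReal.ofReal t⁻¹ * φ univ) ^ δ⁻¹).toNNReal (fun x hx => by
      rw [← ENNReal.coe_le_coe, ENNReal.coe_toNNReal hΛ, ENNReal.le_rpow_inv_iff hδ]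
      exact (hrφ x hx).trans (by gcongr; exact hφmono _))
  have hcount : Countable S := (hSd.countable_of_isOpen (fun _ _ => isOpen_ball)
    (fun j hj => ⟨j, mem_ball_self (hr j (hSF hj))⟩)).to_subtype
  have hsum : ∑' j : S, φ (ball (j : EuclideanSpace ℝ (Fin n)) (r j)) ≤
      (2 * 3 ^ δ + 3 ^ n) * φ univ := by
    rw [hφ, ← lintegral_tsum
      fun j => (measurable_hausdorffContent_superlevel δ _ _).aemeasurable,
      ← lintegral_const_mul' _ _ (by finiteness [hrp 3])]
    refine lintegral_mono fun s => ?_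
    refine le_trans (le_of_eq ?_) (tsum_hausdorffContent_inter_le hn hδ hSd hSp
      {x ∈ univ | ENNReal.ofReal s < (f x).abs})
    refine tsum_congr fun j => ?_
    congr 1
    ext y
    simp
  calc hausdorffContent δ F ≤ (3 ^ δ + 11 ^ δ) * ∑' j : S, (r j : ℝ≥0∞) ^ δ := hS
    _ ≤ (3 ^ δ + 11 ^ δ) * (2 * ENNReal.ofReal t⁻¹ * ((2 * 3 ^ δ + 3 ^ n) * φ univ)) := by
        gcongr
        refine (ENNReal.tsum_le_tsum fun j : S => hrφ j (hSF j.2)).trans ?_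
        rw [ENNReal.tsum_mul_left]
        gcongr
    _ = _ := by ring

/-- Strong-type bound for the maximal function of order `0`, by Marcinkiewicz interpolation of the
weak-type bound with the trivial `L^∞` bound. -/
theorem exists_choquetIntegral_maximal_rpow_le {n : ℕ} (hn : 1 ≤ n) {δ p : ℝ} (hδ : 0 < δ)
    (hδn : δ < n) (hp : 1 < p) :
    ∃ C : ℝ≥0∞, C ≠ ∞ ∧ ∀ (f : EuclideanSpace ℝ (Fin n) → EReal) (c : ℝ), 0 < c →
      choquetIntegral (hausdorffContent δ) univ
          (fun x => ENNReal.ofReal c * contentMaximalFunction δ 0 f x ^ p) ≤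
        ENNReal.ofReal c *
          (C * choquetIntegral (hausdorffContent δ) univ (fun x => (f x).abs ^ p)) := by
  obtain ⟨C, hC, hweak⟩ := exists_hausdorffContent_maximal_superlevel_le hn hδ hδn
  refine ⟨C * ENNReal.ofReal (2 ^ (p - 1) / (p - 1)), by finiteness, fun f c hc => ?_⟩
  have hp0 : 0 < p := by linarith
  rw [choquetIntegral_const_mul_rpow _ _ hp0 hc, choquetIntegral_rpow _ _ hp0, mul_assoc,
    ← lintegral_rpow_mul_lintegral_Ioi_half (measurable_hausdorffContent_superlevel δ _ _) hp,
    ← lintegral_const_mul' C _ hC]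
  refine mul_le_mul_right ?_ _
  refine setLIntegral_mono' measurableSet_Ioi fun t (ht : 0 < t) => ?_
  refine (mul_le_mul_right (hweak f t ht) _).trans (le_of_eq ?_)
  have : ENNReal.ofReal (p * t ^ (p - 2)) =
      ENNReal.ofReal (p * t ^ (p - 1)) * ENNReal.ofReal t⁻¹ := by
    rw [← ENNReal.ofReal_mul (by positivity)]
    congr 1
    rw [show p - 2 = (p - 1) - 1 by ring, Real.rpow_sub_one ht.ne' (p - 1)]
    ring
  rw [this]
  ring

/-- Jensen-type bound for the average of `g` over a ball in terms of a positive upper bound `a` of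
the Choquet `L^p` norm of `g`, by truncation at the height `a * r ^ (-δ / p)`. -/
theorem choquetIntegral_ball_div_le {n : ℕ} (hn : 1 ≤ n) {δ p : ℝ} (hδ : 0 < δ) (hδn : δ < n)
    (hp : 1 < p) (g : EuclideanSpace ℝ (Fin n) → ℝ≥0∞) {a : ℝ} (ha : 0 < a)
    (hga : choquetIntegral (hausdorffContent δ) univ (fun x => g x ^ p) ≤ ENNReal.ofReal (a ^ p))
    (x : EuclideanSpace ℝ (Fin n)) {r : ℝ} (hr : 0 < r) :
    choquetIntegral (hausdorffContent δ) (ball x r) g / hausdorffContent δ (ball x r) ≤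
      ENNReal.ofReal (2 * a * r ^ (-δ / p)) := by
  have hp0 : 0 < p := by linarith
  have hball : hausdorffContent δ (ball x r) = ENNReal.ofReal (r ^ δ) := by
    lift r to ℝ≥0 using hr.le
    rw [hausdorffContent_ball hn hδ hδn, ← ENNReal.ofReal_rpow_of_pos hr,
      ENNReal.ofReal_coe_nnreal]
  have hrδ : 0 < r ^ δ := Real.rpow_pos_of_pos hr δ
  set l := a * r ^ (-δ / p) with hl
  have hl0 : 0 < l := by positivity
  have htail : ∫⁻ s in Ioi l, hausdorffContent δ {y ∈ ball x r | ENNReal.ofReal s < g y} ≤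
      ENNReal.ofReal (l ^ (1 - p)) * ENNReal.ofReal (a ^ p) := by
    refine le_trans ?_ (mul_le_mul_right hga _)
    rw [choquetIntegral_rpow _ _ hp0, ← lintegral_const_mul' _ _ ENNReal.ofReal_ne_top]
    refine le_trans (setLIntegral_mono' measurableSet_Ioi fun s (hs : l < s) => ?_)
      (lintegral_mono_set (Ioi_subset_Ioi hl0.le))
    rw [← mul_assoc, ← ENNReal.ofReal_mul (by positivity)]
    have h1 : 1 ≤ l ^ (1 - p) * (p * s ^ (p - 1)) := by
      have h2 : l ^ (p - 1) ≤ s ^ (p - 1) := Real.rpow_le_rpow hl0.le hs.le (by linarith)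
      have h3 : l ^ (1 - p) * l ^ (p - 1) = 1 := by
        rw [← Real.rpow_add hl0]; simp
      have h4 : 0 < l ^ (1 - p) := Real.rpow_pos_of_pos hl0 _
      have h5 := mul_le_mul_of_nonneg_left h2 h4.le
      nlinarith
    refine (hausdorffContent_mono (B := {y ∈ univ | ENNReal.ofReal s < g y})
      fun y hy => ⟨mem_univ y, hy.2⟩).trans ?_
    exact le_mul_of_one_le_left' (by simpa using h1)
  have hlp : l ^ (1 - p) * a ^ p = l * r ^ δ := by
    have h1 : a = l * r ^ (δ / p) := by
      rw [hl, mul_assoc, ← Real.rpow_add hr, neg_div, neg_add_cancel, Real.rpow_zero, mul_one]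
    rw [h1, Real.mul_rpow hl0.le (by positivity), ← Real.rpow_mul hr.le, div_mul_cancel₀ _ hp0.ne',
      ← mul_assoc, ← Real.rpow_add hl0, sub_add_cancel, Real.rpow_one]
  have hmain := (choquetIntegral_le_add (δ := δ) (ball x r) g hl0.le).trans
    (add_le_add_right htail _)
  rw [hball, ← ENNReal.ofReal_mul hl0.le, ← ENNReal.ofReal_mul (by positivity), hlp,
    ← ENNReal.ofReal_add (by positivity) (by positivity)] at hmain
  rw [hball, ENNReal.div_le_iff (by simpa using hrδ) ENNReal.ofReal_ne_top,
    ← ENNReal.ofReal_mul (by positivity)]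
  refine hmain.trans (ENNReal.ofReal_le_ofReal (le_of_eq ?_))
  rw [hl]
  ring

/-- Hedberg's pointwise inequality: the fractional maximal function is bounded by a geometric mean
of the `L^p` norm and the maximal function of order `0`. -/
theorem contentMaximalFunction_le_rpow_mul {n : ℕ} (hn : 1 ≤ n) {δ κ p : ℝ} (hδ : 0 < δ)
    (hδn : δ < n) (hκ : 0 ≤ κ) (hp : 1 < p) (hpκ : p * κ < δ)
    (f : EuclideanSpace ℝ (Fin n) → EReal) {a : ℝ} (ha : 0 < a)
    (hfa : choquetIntegral (hausdorffContent δ) univ (fun x => (f x).abs ^ p) ≤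
      ENNReal.ofReal (a ^ p)) (x : EuclideanSpace ℝ (Fin n)) :
    contentMaximalFunction δ κ f x ≤ ENNReal.ofReal ((2 * a) ^ (p * κ / δ)) *
      contentMaximalFunction δ 0 f x ^ (1 - p * κ / δ) := by
  have hp0 : 0 < p := by linarith
  set θ := p * κ / δ with hθ
  have hθ0 : 0 ≤ θ := by positivity
  have hθ1 : θ < 1 := (div_lt_one hδ).2 hpκ
  refine iSup₂_le fun r hr => ?_
  set A := choquetIntegral (hausdorffContent δ) (ball x r) (fun y => (f y).abs) /
    hausdorffContent δ (ball x r) with hA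
  have hAM : A ≤ contentMaximalFunction δ 0 f x := by
    refine le_trans (le_of_eq ?_) (le_iSup₂ (f := fun (r : ℝ) (_ : 0 < r) =>
      ENNReal.ofReal r ^ (0 : ℝ) / hausdorffContent δ (ball x r) *
      choquetIntegral (hausdorffContent δ) (ball x r) (fun y => (f y).abs)) r hr)
    rw [ENNReal.rpow_zero, one_div, mul_comm, ← div_eq_mul_inv]
  have hAa : A ≤ ENNReal.ofReal (2 * a * r ^ (-δ / p)) :=
    choquetIntegral_ball_div_le hn hδ hδn hp _ ha hfa x hr
  calc ENNReal.ofReal r ^ κ / hausdorffContent δ (ball x r) *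
        choquetIntegral (hausdorffContent δ) (ball x r) (fun y => (f y).abs)
      = ENNReal.ofReal (r ^ κ) * A := by
        rw [hA, ENNReal.ofReal_rpow_of_pos hr, div_eq_mul_inv, div_eq_mul_inv]
        ring
    _ = ENNReal.ofReal (r ^ κ) * (A ^ θ * A ^ (1 - θ)) := by
        rw [← ENNReal.rpow_add_of_nonneg _ _ hθ0 (by linarith), add_sub_cancel, ENNReal.rpow_one]
    _ ≤ ENNReal.ofReal (r ^ κ) * (ENNReal.ofReal (2 * a * r ^ (-δ / p)) ^ θ *
          contentMaximalFunction δ 0 f x ^ (1 - θ)) := by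
        have h1 := ENNReal.rpow_le_rpow hAa hθ0
        have h2 := ENNReal.rpow_le_rpow hAM (by linarith : 0 ≤ 1 - θ)
        gcongr
    _ = ENNReal.ofReal ((2 * a) ^ θ) * contentMaximalFunction δ 0 f x ^ (1 - θ) := by
        rw [← mul_assoc, ENNReal.ofReal_rpow_of_pos (by positivity),
          ← ENNReal.ofReal_mul (by positivity)]
        congr 2
        have h3 : -δ / p * θ = -κ := by rw [hθ]; field_simp
        rw [Real.mul_rpow (by positivity) (by positivity), ← Real.rpow_mul hr.le, h3,
          Real.rpow_neg hr.le]
        have := (Real.rpow_pos_of_pos hr κ).ne'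
        field_simp

theorem mainTheorem6 (n : ℕ) (hn : 1 ≤ n) (δ κ p : ℝ) (hδ : 0 < δ) (hδn : δ < n)
    (hκ : 0 ≤ κ) (hκδ : κ < δ) (hp : 1 < p) (hpκ : p * κ < δ) :
    ∃ c : ℝ≥0, ∀ f : EuclideanSpace ℝ (Fin n) → EReal,
      IsQuasicontinuous (hausdorffContent δ) f →
        (choquetIntegral (hausdorffContent δ) Set.univ
            (fun x => contentMaximalFunction δ κ f x ^ (δ * p / (δ - p * κ)))) ^
            ((δ - p * κ) / (δ * p)) ≤
          (c : ℝ≥0∞) *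
            (choquetIntegral (hausdorffContent δ) Set.univ (fun x => (f x).abs ^ p)) ^ (1 / p) := by
  have hp0 : 0 < p := by linarith
  have hd : 0 < δ - p * κ := by linarith
  obtain ⟨C, hC, hstrong⟩ := exists_choquetIntegral_maximal_rpow_le hn hδ hδn hp
  set q := δ * p / (δ - p * κ) with hq
  set θ := p * κ / δ with hθ
  have hq0 : 0 < q := by positivity
  have hθ0 : 0 ≤ θ := by positivity
  have hθq : (1 - θ) * q = p := by rw [hθ, hq]; field_simp
  have hqinv : (δ - p * κ) / (δ * p) = q⁻¹ := by rw [hq, inv_div]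
  have hpq : p * q⁻¹ = 1 - θ := by rw [← hθq, mul_assoc, mul_inv_cancel₀ hq0.ne', mul_one]
  have hKt : ENNReal.ofReal (2 ^ θ) * C ^ q⁻¹ ≠ ∞ := by
    finiteness [ENNReal.rpow_ne_top_of_nonneg (inv_nonneg.2 hq0.le) hC]
  refine ⟨(ENNReal.ofReal (2 ^ θ) * C ^ q⁻¹).toNNReal + 1, fun f _ => ?_⟩
  rw [hqinv, one_div, ENNReal.coe_add, ENNReal.coe_toNNReal hKt, ENNReal.coe_one]
  set N := choquetIntegral (hausdorffContent δ) Set.univ (fun x => (f x).abs ^ p)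
  -- The estimate holds with any real `a > N ^ (1 / p)` in place of `N ^ (1 / p)`, which avoids
  -- treating `N = 0` separately.
  have key : ∀ a : ℝ≥0, N ^ p⁻¹ < a →
      choquetIntegral (hausdorffContent δ) univ (fun x => contentMaximalFunction δ κ f x ^ q) ^
        q⁻¹ ≤ ENNReal.ofReal (2 ^ θ) * C ^ q⁻¹ * a := by
    intro a ha
    have ha0 : (0 : ℝ) < a := by
      have : (0 : ℝ≥0∞) < a := bot_le.trans_lt ha
      exact_mod_cast this
    have hNa : N ≤ ENNReal.ofReal ((a : ℝ) ^ p) := by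
      rw [← ENNReal.ofReal_rpow_of_pos ha0, ENNReal.ofReal_coe_nnreal,
        ← ENNReal.rpow_inv_le_iff hp0]
      exact ha.le
    have hc : 0 < ((2 * a : ℝ) ^ θ) ^ q := by positivity
    calc choquetIntegral (hausdorffContent δ) univ
          (fun x => contentMaximalFunction δ κ f x ^ q) ^ q⁻¹
        ≤ (choquetIntegral (hausdorffContent δ) univ (fun x =>
            ENNReal.ofReal (((2 * a : ℝ) ^ θ) ^ q) * contentMaximalFunction δ 0 f x ^ p)) ^
              q⁻¹ := by
          refine ENNReal.rpow_le_rpow (choquetIntegral_mono subset_rfl fun x => ?_)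
            (inv_nonneg.2 hq0.le)
          refine (ENNReal.rpow_le_rpow (contentMaximalFunction_le_rpow_mul hn hδ hδn hκ hp hpκ f
            ha0 hNa x) hq0.le).trans (le_of_eq ?_)
          rw [ENNReal.mul_rpow_of_nonneg _ _ hq0.le, ← ENNReal.rpow_mul, ← hθ, hθq,
            ENNReal.ofReal_rpow_of_pos (by positivity)]
      _ ≤ (ENNReal.ofReal (((2 * a : ℝ) ^ θ) ^ q) * (C * ENNReal.ofReal ((a : ℝ) ^ p))) ^ q⁻¹ := by
          refine ENNReal.rpow_le_rpow ((hstrong f _ hc).trans ?_) (inv_nonneg.2 hq0.le)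
          gcongr
      _ = ENNReal.ofReal (2 ^ θ) * C ^ q⁻¹ * a := by
          have hq1 : 0 ≤ q⁻¹ := inv_nonneg.2 hq0.le
          rw [ENNReal.mul_rpow_of_nonneg _ _ hq1, ENNReal.mul_rpow_of_nonneg _ _ hq1,
            ENNReal.ofReal_rpow_of_pos hc, Real.rpow_rpow_inv (by positivity) hq0.ne',
            ENNReal.ofReal_rpow_of_pos (by positivity), ← Real.rpow_mul ha0.le, hpq,
            Real.mul_rpow zero_le_two ha0.le, ENNReal.ofReal_mul (by positivity)]
          have h1 : ENNReal.ofReal ((a : ℝ) ^ θ) * ENNReal.ofReal ((a : ℝ) ^ (1 - θ)) = a := by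
            rw [← ENNReal.ofReal_mul (by positivity), ← Real.rpow_add ha0, add_sub_cancel,
              Real.rpow_one, ENNReal.ofReal_coe_nnreal]
          rw [mul_assoc, mul_left_comm (ENNReal.ofReal ((a : ℝ) ^ θ)), h1, mul_assoc]
  set K := ENNReal.ofReal (2 ^ θ) * C ^ q⁻¹ with hK
  have hK0 : K + 1 ≠ 0 := by simp
  have hKt' : K + 1 ≠ ∞ := by finiteness
  rw [mul_comm, ← ENNReal.div_le_iff hK0 hKt']
  refine le_of_forall_gt_imp_ge_of_dense fun a ha => ?_
  rcases eq_or_ne a ∞ with rfl | hat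
  · exact le_top
  lift a to ℝ≥0 using hat
  rw [ENNReal.div_le_iff hK0 hKt', mul_comm]
  exact (key a ha).trans (mul_le_mul_left le_self_add _)
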